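/- Let $(\Gamma,\mu)$ be a $\sigma$-finite measure space and let $L^2_c(\Gamma,\mu)$ be the Hilbert space of complex square-integrable functions with $\langle f,g\rangle=\int_\Gamma f\,\overline{g}\,d\mu$. Let $\mathcal K:\Gamma\times\Gamma\to\mathbb C$ be a Hilbert–Schmidt kernel, i.e. $\mathcal K\in L^2_c(\Gamma\times\Gamma,\mu\otimes\mu)$, which is complex symmetric: $\mathcal K(x,y)=\mathcal K(y,x)$ for $\mu\otimes\mu$-almost all $(x,y)$ (in particular if this holds for all $x,y$). Then $$\mathbf K f(x)=\int_\Gamma \mathcal K(x,y)f(y)\,d\mu(y)$$ (the integral converging absolutely for almost every $x$) defines a bounded linear operator $\mathbf K$ on $L^2_c(\Gamma,\mu)$, and: 1. $\mathbf K$ is compact. 2. The map $\mathbf C f=\bar f$ is a conjugation on $L^2_c(\Gamma,\mu)$, i.e. it is antilinear, $\mathbf C^2=\mathbf I$ and $\langle f,g\rangle=\langle \mathbf C g,\mathbf C f\rangle$; and $\mathbf K$ is $\mathbf C$-symmetric, i.e. $\mathbf C\mathbf K=\mathbf K^*\mathbf C$. 3. Let $|\mathbf K|=(\mathbf K^*\mathbf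 K)^{1/2}$. There are an index set $N\subseteq\mathbb N$, numbers $\lambda_n\ge 0$ and an orthonormal family $(\phi_n)_{n\in N}$ in $L^2_c(\Gamma,\mu)$ with $|\mathbf K|\phi_n=\lambda_n\phi_n$ for all $n\in N$, such that $$\mathbf K=\sum_{n\in N}\lambda_n\langle\cdot,\phi_n\rangle\,\overline{\phi_n},$$ where the sum converges unconditionally in operator norm. The set $\{\lambda_n:n\in N\}$ is exactly the set of eigenvalues of $|\mathbf K|$. For each real $z\neq0$, the eigenspace $\ker(|\mathbf K|-z)$ is the linear span of the $\phi_n$ with $\lambda_n=z$, so nonzero eigenvalues are repeated according to multiplicity. If $L^2_c(\Gamma,\mu)$ is separable, then the closed linear span of $(\phi_n)_{n\in N}$ is all of $L^2_c(\Gamma,\mu)$. -/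

import Mathlib

open MeasureTheory
open scoped ENNReal

/-- `T` is the integral operator `T f (x) = ∫ K(x, y) f(y) dμ(y)` on the complex Hilbert space
`L²(Γ, μ)`: for every `f` the integral converges absolutely for almost every `x`, and its value is
`T f (x)` for almost every `x`. -/
def IsIntegralOperator {Γ : Type*} [MeasurableSpace Γ] (μ : Measure Γ) (K : Γ → Γ → ℂ)
    (T : Lp ℂ 2 μ →L[ℂ] Lp ℂ 2 μ) : Prop :=
  ∀ f : Lp ℂ 2 μ, (∀ᵐ x ∂μ, Integrable (fun y => K x y * f y) μ) ∧
    T f =ᵐ[μ] fun x => ∫ y, K x y * f y ∂μ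

/-- The kernel determines its integral operator. -/
theorem IsIntegralOperator.unique {Γ : Type*} [MeasurableSpace Γ] {μ : Measure Γ}
    {K : Γ → Γ → ℂ} {T S : Lp ℂ 2 μ →L[ℂ] Lp ℂ 2 μ}
    (hT : IsIntegralOperator μ K T) (hS : IsIntegralOperator μ K S) : T = S :=
  ContinuousLinearMap.ext fun f => Lp.ext ((hT f).2.trans (hS f).2.symm)

/-- A conjugation (`C`-operator) on a complex Hilbert space: an antilinear isometric involution. -/
structure IsConjugationOperator {H : Type*} [NormedAddCommGroup H] [InnerProductSpace ℂ H]
    (C : H → H) : Prop where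
  antilinear : ∀ (a b : ℂ) (x y : H),
    C (a • x + b • y) = (starRingEnd ℂ) a • C x + (starRingEnd ℂ) b • C y
  involutive : ∀ x : H, C (C x) = x
  isometric : ∀ x y : H, inner ℂ x y = inner ℂ (C y) (C x)

/-- A bounded operator `T` is `C`-symmetric, for a conjugation `C`, if `C T = T* C`. -/
structure IsCSymmetric {H : Type*} [NormedAddCommGroup H] [InnerProductSpace ℂ H]
    [CompleteSpace H] (C : H → H) (T : H →L[ℂ] H) : Prop where
  conjugation : IsConjugationOperator C
  comm : ∀ x : H, C (T x) = ContinuousLinearMap.adjoint T (C x)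

/-- Pointwise complex conjugation `f ↦ \bar f` on `L²(Γ, μ)`. -/
noncomputable def conjLp {Γ : Type*} [MeasurableSpace Γ] (μ : Measure Γ) (f : Lp ℂ 2 μ) :
    Lp ℂ 2 μ := star f

/-- `conjLp` is given by conjugating the values. -/
theorem conjLp_coe {Γ : Type*} [MeasurableSpace Γ] (μ : Measure Γ) (f : Lp ℂ 2 μ) :
    conjLp μ f =ᵐ[μ] fun x => (starRingEnd ℂ) (f x) :=
  Lp.coeFn_star f

/-- The modulus `|T| = (T* T)^(1/2)` of a bounded operator, the square root being the positive
one. -/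
noncomputable def operatorModulus {H : Type*} [NormedAddCommGroup H] [InnerProductSpace ℂ H]
    [CompleteSpace H] (T : H →L[ℂ] H) : H →L[ℂ] H :=
  CFC.sqrt (ContinuousLinearMap.adjoint T * T)

/-! For a compact `C`-symmetric `T`, the antilinear map `A = C T` satisfies `⟨A x, y⟩ = ⟨A y, x⟩`,
so it is compact and self-adjoint for the real inner product `Re ⟨x, y⟩`. The real spectral theorem
supplies eigenvectors with real eigenvalue, and multiplying one by `i` flips the sign of its
eigenvalue. A maximality argument then yields a complex orthonormal basis with `A b = l b`, `l ≥ 0`,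
that is `T b = l C b` (`IsCSymmetric.exists_hilbertBasis`).

Since `T* = C T C`, this gives `T* T b = l² b`, hence `|T| b = l b`, and the spectral claims are
read off from the basis. Compactness leaves finitely many `l ≥ ε`, which gives both countability and
norm convergence.

For an integral operator, Fubini and the symmetry of the kernel give `C T = T* C`. Bessel's
inequality for each section `K(x, ·)`, integrated in `x`, bounds the Hilbert–Schmidt sum and so
gives compactness. -/

section Takagi

open Module.End Filter Topology

variable {H : Type*} [NormedAddCommGroup H] [InnerProductSpace ℂ H]

/-! ### Conjugations and Takagi factorization -/

namespace IsConjugationOperator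

variable {C : H → H} (hC : IsConjugationOperator C)
include hC

theorem map_add (x y : H) : C (x + y) = C x + C y := by
  simpa using hC.antilinear 1 1 x y

theorem map_smul (a : ℂ) (x : H) : C (a • x) = (starRingEnd ℂ) a • C x := by
  simpa using hC.antilinear a 0 x 0

theorem map_zero : C 0 = 0 := by
  simpa using hC.map_smul 0 0

theorem map_sub (x y : H) : C (x - y) = C x - C y := by
  simpa [sub_eq_add_neg] using hC.antilinear 1 (-1) x y

theorem norm_map (x : H) : ‖C x‖ = ‖x‖ := by
  rw [@norm_eq_sqrt_re_inner ℂ, @norm_eq_sqrt_re_inner ℂ _ _ _ _ x, ← hC.isometric]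

theorem continuous : Continuous C :=
  (Isometry.of_dist_eq fun x y => by
    rw [dist_eq_norm, dist_eq_norm, ← hC.map_sub, hC.norm_map]).continuous

end IsConjugationOperator

/-- A compact antilinear operator which is symmetric has enough eigenvectors with real
eigenvalue. -/
theorem exists_real_eigenvector_inner_ne_zero [CompleteSpace H] {A : H → H}
    (hadd : ∀ x y, A (x + y) = A x + A y)
    (hsmul : ∀ (a : ℂ) (x : H), A (a • x) = (starRingEnd ℂ) a • A x)
    (hsymm : ∀ x y, inner ℂ (A x) y = inner ℂ (A y) x) (hcont : Continuous A)
    (hcomp : IsCompactOperator A) {w : H} (hw : w ≠ 0) :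
    ∃ (u : H) (σ : ℝ), A u = (σ : ℂ) • u ∧ inner ℂ u w ≠ 0 := by
  let : InnerProductSpace ℝ H := InnerProductSpace.rclikeToReal ℂ H
  let B : H →L[ℝ] H :=
    { toFun := A
      map_add' := hadd
      map_smul' := fun r x => by
        have := hsmul (r : ℂ) x
        simpa using this
      cont := hcont }
  have hB : (B : H →ₗ[ℝ] H).IsSymmetric := fun x y => by
    change (inner ℂ (A x) y).re = (inner ℂ x (A y)).re
    rw [hsymm, ← inner_conj_symm, Complex.conj_re]
  -- Real spectral theorem: a `w` orthogonal to all real eigenvectors would vanish.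
  have hbot := ContinuousLinearMap.orthogonalComplement_iSup_eigenspaces_eq_bot
    (T := B) hcomp hB
  by_contra! hcon
  refine hw ?_
  rw [← Submodule.mem_bot ℝ, ← hbot, Submodule.mem_orthogonal]
  intro u hu
  induction hu using Submodule.iSup_induction' with
  | mem σ x hx =>
    have h1 : A x = (σ : ℂ) • x := by
      have h2 : B x = σ • x := mem_eigenspace_iff.1 hx
      exact h2.trans (Complex.coe_smul σ x).symm
    change (inner ℂ x w).re = 0
    rw [hcon x σ h1, Complex.zero_re]
  | zero => exact inner_zero_left _
  | add x y _ _ hx hy => rw [inner_add_left, hx, hy, add_zero]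

variable [CompleteSpace H]

namespace IsCSymmetric

variable {C : H → H} {T : H →L[ℂ] H} (hT : IsCSymmetric C T)
include hT

theorem inner_conj_apply_comm (x y : H) : inner ℂ (C (T x)) y = inner ℂ (C (T y)) x := by
  rw [hT.comm, ContinuousLinearMap.adjoint_inner_left, hT.conjugation.isometric,
    hT.conjugation.involutive]

theorem adjoint_apply (x : H) : ContinuousLinearMap.adjoint T x = C (T (C x)) := by
  rw [hT.comm, hT.conjugation.involutive]

/-- Takagi's factorization of a compact `C`-symmetric operator. -/
theorem exists_hilbertBasis (hcomp : IsCompactOperator T) :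
    ∃ (ι : Set H) (b : HilbertBasis ι ℂ H) (l : ι → ℝ),
      (∀ i, 0 ≤ l i) ∧ ∀ i, T (b i) = (l i : ℂ) • C (b i) := by
  have hC := hT.conjugation
  set A : H → H := fun x => C (T x) with hA
  have hadd : ∀ x y, A (x + y) = A x + A y := fun x y => by simp [hA, hC.map_add]
  have hsmul : ∀ (a : ℂ) (x : H), A (a • x) = (starRingEnd ℂ) a • A x := fun a x => by
    simp [hA, hC.map_smul]
  have hsymm : ∀ x y, inner ℂ (A x) y = inner ℂ (A y) x := hT.inner_conj_apply_comm
  -- A maximal orthonormal set of eigenvectors of `A` with nonnegative eigenvalue; maximality will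
  -- force it to be complete.
  obtain ⟨s, -, ⟨hs, hs'⟩, hmax⟩ := zorn_subset_nonempty
    {s : Set H | Orthonormal ℂ (Subtype.val : s → H) ∧
      ∀ v ∈ s, ∃ r : ℝ, 0 ≤ r ∧ A v = (r : ℂ) • v}
    (fun c hc cc _ => ⟨⋃₀ c, ⟨orthonormal_sUnion_of_directed cc.directedOn
      fun x hx => (hc hx).1, fun v ⟨t, ht, hv⟩ => (hc ht).2 v hv⟩,
      fun _ => Set.subset_sUnion_of_mem⟩) ∅ (by simp)
  have hperp : (Submodule.span ℂ s)ᗮ = ⊥ := by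
    set W := (Submodule.span ℂ s)ᗮ with hW
    have hWinv : ∀ x ∈ W, A x ∈ W := fun x hx => by
      rw [hW, Submodule.mem_orthogonal']
      refine fun u hu => ?_
      rw [hsymm]
      induction hu using Submodule.span_induction with
      | mem v hv =>
        obtain ⟨r, -, hr⟩ := hs' v hv
        rw [hr, inner_smul_left, Submodule.mem_orthogonal _ x |>.1 hx v (Submodule.subset_span hv),
          mul_zero]
      | zero => simp [hA, hC.map_zero]
      | add u v _ _ hu hv => rw [hadd, inner_add_left, hu, hv, add_zero]
      | smul a u _ hu => rw [hsmul, inner_smul_left, hu, mul_zero]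
    rw [Submodule.eq_bot_iff]
    by_contra! ⟨w, hwW, hw⟩
    obtain ⟨u, σ, hu, huw⟩ := exists_real_eigenvector_inner_ne_zero hadd hsmul hsymm
      (hC.continuous.comp T.continuous) (hcomp.continuous_comp hC.continuous) hw
    -- `A` preserves both `W` and `Wᗮ`, so the `W`-component of the eigenvector `u` is again an
    -- eigenvector; it is nonzero because `u` is not orthogonal to `w ∈ W`.
    set p := W.starProjection u with hp
    have hpW : p ∈ W := Submodule.starProjection_apply_mem W u
    have hq : u - p ∈ Wᗮ := Submodule.sub_starProjection_mem_orthogonal u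
    have hAq : A (u - p) ∈ Wᗮ := by
      rw [Submodule.mem_orthogonal']
      intro x hx
      rw [hsymm]
      exact Submodule.mem_orthogonal _ _ |>.1 hq _ (hWinv x hx)
    have hAp : A p = (σ : ℂ) • p := by
      have h1 : A p + A (u - p) = (σ : ℂ) • p + (σ : ℂ) • (u - p) := by
        rw [← hadd, ← smul_add, add_sub_cancel, hu]
      have h2 : A p - (σ : ℂ) • p = (σ : ℂ) • (u - p) - A (u - p) := by
        rw [sub_eq_sub_iff_add_eq_add, h1, add_comm]
      have h3 : A p - (σ : ℂ) • p ∈ W ⊓ Wᗮ :=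
        ⟨W.sub_mem (hWinv p hpW) (W.smul_mem _ hpW),
          h2 ▸ Wᗮ.sub_mem (Wᗮ.smul_mem _ hq) hAq⟩
      rw [Submodule.inf_orthogonal_eq_bot, Submodule.mem_bot] at h3
      exact sub_eq_zero.1 h3
    have hp0 : p ≠ 0 := fun h0 => huw <| by
      rw [h0, sub_zero] at hq
      rw [Submodule.mem_orthogonal' W u] at hq
      exact hq w hwW
    obtain ⟨q, r, hr, hqW, hq0, hAr⟩ :
        ∃ (q : H) (r : ℝ), 0 ≤ r ∧ q ∈ W ∧ q ≠ 0 ∧ A q = (r : ℂ) • q := by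
      rcases le_total 0 σ with h | h
      · exact ⟨p, σ, h, hpW, hp0, hAp⟩
      -- By antilinearity `A (i p) = -i σ p`, so `i p` has eigenvalue `-σ ≥ 0`.
      · refine ⟨Complex.I • p, -σ, by linarith, W.smul_mem _ hpW, by simp [hp0], ?_⟩
        rw [hsmul, hAp, smul_smul, smul_smul]
        simp [mul_comm]
    set e : H := ((‖q‖⁻¹ : ℝ) : ℂ) • q with he
    have he1 : ‖e‖ = 1 := by
      rw [he, norm_smul, Complex.norm_real, norm_inv, norm_norm,
        inv_mul_cancel₀ (norm_ne_zero_iff.2 hq0)]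
    have heW : e ∈ W := W.smul_mem _ hqW
    have hAe : A e = (r : ℂ) • e := by
      rw [he, hsmul, hAr, Complex.conj_ofReal, smul_comm]
    have hse : ∀ v ∈ s, inner ℂ v e = 0 := fun v hv =>
      Submodule.mem_orthogonal _ _ |>.1 heW v (Submodule.subset_span hv)
    have hes : e ∈ s := by
      refine hmax (y := insert e s) ⟨?_, ?_⟩ (Set.subset_insert _ _) (Set.mem_insert _ _)
      · refine ⟨fun ⟨v, hv⟩ => ?_, fun ⟨v, hv⟩ ⟨v', hv'⟩ hne => ?_⟩
        · rcases hv with rfl | hv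
          · exact he1
          · exact hs.1 ⟨v, hv⟩
        · have hne' : v ≠ v' := fun h => hne (Subtype.ext h)
          rcases hv with rfl | hv <;> rcases hv' with rfl | hv'
          · exact absurd rfl hne'
          · exact inner_eq_zero_symm.1 (hse v' hv')
          · exact hse v hv
          · exact hs.2 (i := ⟨v, hv⟩) (j := ⟨v', hv'⟩) fun h => hne' (Subtype.ext_iff.1 h)
      · rintro v (rfl | hv)
        · exact ⟨r, hr, hAe⟩
        · exact hs' v hv
    have := hse e hes
    rw [inner_self_eq_zero] at this
    simp [this] at he1
  choose l hl0 hl using hs'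
  refine ⟨s, HilbertBasis.mkOfOrthogonalEqBot hs (by simpa using hperp),
    fun i => l i.1 i.2, fun i => hl0 _ _, fun i => ?_⟩
  rw [HilbertBasis.coe_mkOfOrthogonalEqBot]
  have := congrArg C (hl i.1 i.2)
  rwa [hA, hC.involutive, hC.map_smul, Complex.conj_ofReal] at this

end IsCSymmetric

end Takagi

/-! ### The operator modulus -/

section Modulus

variable {H : Type*} [NormedAddCommGroup H] [InnerProductSpace ℂ H] [CompleteSpace H]

theorem operatorModulus_nonneg (T : H →L[ℂ] H) : 0 ≤ operatorModulus T :=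
  CFC.sqrt_nonneg _

theorem operatorModulus_isPositive (T : H →L[ℂ] H) : (operatorModulus T).IsPositive :=
  (ContinuousLinearMap.nonneg_iff_isPositive _).1 (operatorModulus_nonneg T)

theorem operatorModulus_inner_left (T : H →L[ℂ] H) (x y : H) :
    inner ℂ (operatorModulus T x) y = inner ℂ x (operatorModulus T y) :=
  (operatorModulus_isPositive T).isSymmetric x y

theorem operatorModulus_mul_self (T : H →L[ℂ] H) :
    operatorModulus T * operatorModulus T = ContinuousLinearMap.adjoint T * T :=
  CFC.sqrt_mul_sqrt_self _ (star_mul_self_nonneg T)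

/-- With `S = |T|`, the vector `w = S v - r v` satisfies `S w = -r w`, which positivity of `S`
excludes for `r > 0` unless `w = 0`. For `r = 0`, `‖S v‖² = ⟨v, S² v⟩ = 0`. -/
theorem operatorModulus_apply_of_adjoint_apply {T : H →L[ℂ] H} {v : H} {r : ℝ} (hr : 0 ≤ r)
    (h : ContinuousLinearMap.adjoint T (T v) = ((r * r : ℝ) : ℂ) • v) :
    operatorModulus T v = (r : ℂ) • v := by
  set S := operatorModulus T with hS
  have hSS : S (S v) = ((r * r : ℝ) : ℂ) • v := by
    rw [← h]
    exact congrArg (fun R : H →L[ℂ] H => R v) (operatorModulus_mul_self T)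
  rcases hr.eq_or_lt with rfl | hr
  · have : inner ℂ (S v) (S v) = 0 := by
      rw [← operatorModulus_inner_left, ← hS, hSS]; simp
    simpa using this
  · set w := S v - (r : ℂ) • v with hw
    have hSw : S w = -((r : ℂ) • w) := by
      rw [hw, _root_.map_sub, _root_.map_smul, hSS, smul_sub, smul_smul]
      push_cast
      abel
    have hpos := (operatorModulus_isPositive T).re_inner_nonneg_left w
    rw [← hS, hSw, inner_neg_left, inner_smul_left, Complex.conj_ofReal,
      inner_self_eq_norm_sq_to_K] at hpos
    have h2 : 0 ≤ -(r * ‖w‖ ^ 2) := by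
      have : (RCLike.re (-((r : ℂ) * ((‖w‖ : ℝ) : ℂ) ^ 2)) : ℝ) = -(r * ‖w‖ ^ 2) := by
        norm_cast
      exact this ▸ hpos
    have h3 : ‖w‖ = 0 := by
      by_contra hne
      have : 0 < r * ‖w‖ ^ 2 := by positivity
      linarith
    exact sub_eq_zero.1 (norm_eq_zero.1 h3)

end Modulus

/-! ### Spectral data and the norm-convergent expansion -/

section Expansion

open Module.End Filter Topology

variable {H : Type*} [NormedAddCommGroup H] [InnerProductSpace ℂ H]

/-- An orthonormal family in a separable space is countable. -/
theorem Orthonormal.countable_of_separableSpace [TopologicalSpace.SeparableSpace H] {ι : Type*}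
    {v : ι → H} (hv : Orthonormal ℂ v) : Countable ι := by
  refine Pairwise.countable_of_isOpen_disjoint (s := fun i => Metric.ball (v i) (1 / 2))
    (fun i j hij => ?_) (fun _ => Metric.isOpen_ball) fun i => ⟨v i, by simp⟩
  refine Metric.ball_disjoint_ball ?_
  -- Distinct members are `√2 > 1` apart, so balls of radius `1/2` are disjoint.
  have h1 : ‖v i - v j‖ * ‖v i - v j‖ = 2 := by
    rw [@norm_sub_mul_self ℂ, hv.2 hij, hv.1 i, hv.1 j]
    norm_num
  rw [dist_eq_norm]
  nlinarith [norm_nonneg (v i - v j)]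

theorem HilbertBasis.hasSum_norm_inner_sq {ι : Type*} (b : HilbertBasis ι ℂ H) (x : H) :
    HasSum (fun i => ‖inner ℂ (b i) x‖ ^ 2) (‖x‖ ^ 2) := by
  have h := Complex.hasSum_re (b.hasSum_inner_mul_inner x x)
  convert h using 1
  · ext i
    rw [← inner_conj_symm x (b i), ← Complex.normSq_eq_conj_mul_self, Complex.ofReal_re,
      Complex.normSq_eq_norm_sq]
  · rw [inner_self_eq_norm_sq_to_K]
    norm_cast

variable [CompleteSpace H]

namespace IsCSymmetric

variable {C : H → H} {T : H →L[ℂ] H} {ι : Type*} {b : HilbertBasis ι ℂ H} {l : ι → ℝ}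

theorem operatorModulus_basis_apply (hT : IsCSymmetric C T) (hl0 : ∀ i, 0 ≤ l i)
    (hl : ∀ i, T (b i) = (l i : ℂ) • C (b i)) (i : ι) :
    operatorModulus T (b i) = (l i : ℂ) • b i := by
  have hC := hT.conjugation
  refine operatorModulus_apply_of_adjoint_apply (hl0 i) ?_
  rw [hT.adjoint_apply, hl, hC.map_smul, hC.involutive, Complex.conj_ofReal, _root_.map_smul, hl,
    hC.map_smul, hC.map_smul, hC.involutive, Complex.conj_ofReal, smul_smul]
  push_cast
  rfl

/-- The vectors `T (b i)` are orthogonal of norm `|l i|`, so infinitely many with `l i ≥ ε` would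
give a sequence in a compact set without Cauchy subsequence. -/
theorem finite_le_singularValue (hT : IsCSymmetric C T) (hcomp : IsCompactOperator T)
    (hl : ∀ i, T (b i) = (l i : ℂ) • C (b i)) {ε : ℝ} (hε : 0 < ε) :
    {i | ε ≤ l i}.Finite := by
  by_contra hinf
  have hC := hT.conjugation
  let u := Set.Infinite.natEmbedding _ hinf
  obtain ⟨K, hK, hKsub⟩ := hcomp.image_closedBall_subset_compact 1
  obtain ⟨a, -, g, hg, hlim⟩ := hK.tendsto_subseq (x := fun n => T (b (u n)))
    fun n => hKsub ⟨_, by simp [b.orthonormal.1], rfl⟩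
  obtain ⟨N, hN⟩ := Metric.cauchySeq_iff'.1 hlim.cauchySeq ε hε
  have h1 := hN (N + 1) (Nat.le_succ N)
  set i := u (g (N + 1))
  set j := u (g N)
  have hij : (j : ι) ≠ i := fun h => by
    have := hg.injective (u.injective (Subtype.ext h))
    omega
  have h2 : ‖T (b i) - T (b j)‖ * ‖T (b i) - T (b j)‖ = l i * l i + l j * l j := by
    rw [@norm_sub_mul_self ℂ, hl, hl, inner_smul_left, inner_smul_right, ← hC.isometric,
      b.orthonormal.2 hij, norm_smul, norm_smul, hC.norm_map, hC.norm_map, b.orthonormal.1,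
      b.orthonormal.1]
    simp
  have h3 : ε ≤ l i := i.2
  simp only [Function.comp_apply, dist_eq_norm] at h1
  change ‖T (b i) - T (b j)‖ < ε at h1
  nlinarith [norm_nonneg (T (b i) - T (b j)), mul_self_nonneg (l j)]

theorem inner_basis_conj_apply (hT : IsCSymmetric C T)
    (hl : ∀ i, T (b i) = (l i : ℂ) • C (b i)) (i : ι) (x : H) :
    inner ℂ (C (T x)) (b i) = (l i : ℂ) * inner ℂ (b i) x := by
  have hC := hT.conjugation
  rw [hT.inner_conj_apply_comm, hl, hC.map_smul, hC.involutive, Complex.conj_ofReal,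
    inner_smul_left, Complex.conj_ofReal]

/-- The singular value expansion of a compact `C`-symmetric operator converges in norm. -/
theorem hasSum_rankOne (hT : IsCSymmetric C T) (hcomp : IsCompactOperator T)
    (hl0 : ∀ i, 0 ≤ l i) (hl : ∀ i, T (b i) = (l i : ℂ) • C (b i)) :
    HasSum (fun i => (l i : ℂ) • InnerProductSpace.rankOne ℂ (C (b i)) (b i)) T := by
  classical
  have hC := hT.conjugation
  rw [HasSum, SummationFilter.unconditional_filter, Metric.tendsto_atTop]
  intro ε hε
  have hfin := hT.finite_le_singularValue hcomp hl (half_pos hε)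
  refine ⟨hfin.toFinset, fun F hF => ?_⟩
  rw [dist_comm, dist_eq_norm]
  refine lt_of_le_of_lt ?_ (half_lt_self hε)
  refine ContinuousLinearMap.opNorm_le_bound _ (half_pos hε).le fun x => ?_
  set g := x - ∑ i ∈ F, inner ℂ (b i) x • b i with hg
  have hTg : (T - ∑ i ∈ F, (l i : ℂ) • InnerProductSpace.rankOne ℂ (C (b i)) (b i)) x = T g := by
    rw [hg, _root_.map_sub, map_sum, _root_.sub_apply, _root_.sum_apply]
    congr 1
    refine Finset.sum_congr rfl fun i _ => ?_
    rw [_root_.map_smul, hl, _root_.smul_apply, InnerProductSpace.rankOne_apply,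
      smul_comm]
  have hgF : ∀ i ∈ F, inner ℂ (b i) g = 0 := fun i hi => by
    rw [hg, inner_sub_right, b.orthonormal.inner_right_sum _ hi, sub_self]
  have hgF' : ∀ i ∉ F, inner ℂ (b i) g = inner ℂ (b i) x := fun i hi => by
    rw [hg, inner_sub_right, inner_sum, Finset.sum_eq_zero, sub_zero]
    intro j hj
    rw [inner_smul_right, b.orthonormal.2 (ne_of_mem_of_not_mem hj hi).symm, mul_zero]
  -- Parseval is applied to `C (T g)`, whose coefficients have modulus `l i * |⟨b i, g⟩|`: zero on
  -- `F`, and off `F` at most `ε / 2` times those of `x`.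
  have h1 := b.hasSum_norm_inner_sq (C (T g))
  have h2 := (b.hasSum_norm_inner_sq x).mul_left ((ε / 2) ^ 2)
  rw [hC.norm_map] at h1
  rw [hTg, ← abs_of_nonneg (norm_nonneg (T g)),
    ← abs_of_nonneg (mul_nonneg (half_pos hε).le (norm_nonneg x)), ← sq_le_sq, mul_pow]
  refine hasSum_le (fun i => ?_) h1 h2
  rw [norm_inner_symm, hT.inner_basis_conj_apply hl, norm_mul, mul_pow, Complex.norm_real]
  by_cases hi : i ∈ F
  · rw [hgF i hi]
    simp only [norm_zero, ne_eq, OfNat.ofNat_ne_zero, not_false_eq_true, zero_pow, mul_zero]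
    positivity
  · have : l i < ε / 2 := by
      by_contra! h
      exact hi (hF (hfin.mem_toFinset.2 h))
    rw [hgF' i hi, Real.norm_eq_abs, abs_of_nonneg (hl0 i)]
    gcongr
    exact hl0 i

theorem eq_of_operatorModulus_apply (hT : IsCSymmetric C T) (hl0 : ∀ i, 0 ≤ l i)
    (hl : ∀ i, T (b i) = (l i : ℂ) • C (b i)) {f : H} {z : ℂ}
    (hf : operatorModulus T f = z • f) {i : ι} (hi : inner ℂ (b i) f ≠ 0) : (l i : ℂ) = z := by
  have h := operatorModulus_inner_left T (b i) f
  rw [hT.operatorModulus_basis_apply hl0 hl, hf, inner_smul_left, inner_smul_right,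
    Complex.conj_ofReal] at h
  exact mul_right_cancel₀ hi h

theorem exists_expansion (hT : IsCSymmetric C T) (hcomp : IsCompactOperator T) :
    ∃ (N : Set ℕ) (l : N → ℝ) (φ : N → H),
      Orthonormal ℂ φ ∧
      (∀ n, 0 ≤ l n) ∧
      (∀ n, operatorModulus T (φ n) = (l n : ℂ) • φ n) ∧
      Set.range (fun n => (l n : ℂ)) =
        {z : ℂ | HasEigenvalue (operatorModulus T : H →ₗ[ℂ] H) z} ∧
      (∀ z : ℝ, z ≠ 0 → Submodule.span ℂ (φ '' {n | l n = z}) =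
        eigenspace (operatorModulus T : H →ₗ[ℂ] H) (z : ℂ)) ∧
      (TopologicalSpace.SeparableSpace H →
        (Submodule.span ℂ (Set.range φ)).topologicalClosure = ⊤) ∧
      HasSum (fun n => (l n : ℂ) • InnerProductSpace.rankOne ℂ (C (φ n)) (φ n)) T := by
  obtain ⟨ι, b, l, hl0, hl⟩ := hT.exists_hilbertBasis hcomp
  have hcount : {i | 0 < l i}.Countable := by
    have : {i | 0 < l i} = ⋃ n : ℕ, {i | 1 / ((n : ℝ) + 1) ≤ l i} := by
      ext i
      simp only [Set.mem_ofPred_eq, Set.mem_iUnion]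
      refine ⟨fun h => ?_, fun ⟨n, hn⟩ => lt_of_lt_of_le (by positivity) hn⟩
      obtain ⟨n, hn⟩ := exists_nat_one_div_lt h
      exact ⟨n, hn.le⟩
    rw [this]
    exact Set.countable_iUnion fun n =>
      (hT.finite_le_singularValue hcomp hl (by positivity)).countable
  -- The kernel may have uncountable dimension. In the nonseparable case one kernel vector, if any,
  -- is kept so that `0` is still listed as an eigenvalue.
  obtain ⟨S, hScount, hSpos, hSzero, hSall⟩ : ∃ S : Set ι, S.Countable ∧ (∀ i, 0 < l i → i ∈ S) ∧
      (∀ i, l i = 0 → ∃ j ∈ S, l j = 0) ∧ (TopologicalSpace.SeparableSpace H → S = Set.univ) := by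
    by_cases hsep : TopologicalSpace.SeparableSpace H
    · have := b.orthonormal.countable_of_separableSpace
      exact ⟨Set.univ, Set.countable_univ, by simp, fun i hi => ⟨i, trivial, hi⟩, fun _ => rfl⟩
    · by_cases hz : ∃ i, l i = 0
      · obtain ⟨i, hi⟩ := hz
        exact ⟨insert i {i | 0 < l i}, hcount.insert i, fun j hj => Or.inr hj,
          fun _ _ => ⟨i, Or.inl rfl, hi⟩, fun h => absurd h hsep⟩
      · push Not at hz
        exact ⟨{i | 0 < l i}, hcount, fun _ h => h, fun i hi => absurd hi (hz i),
          fun h => absurd h hsep⟩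
  have : Countable S := hScount.to_subtype
  obtain ⟨f, hf⟩ := exists_injective_nat S
  let e : Set.range f ≃ S := (Equiv.ofInjective f hf).symm
  have hmod := hT.operatorModulus_basis_apply hl0 hl
  have hne : ∀ f : H, f ≠ 0 → ∃ i, inner ℂ (b i) f ≠ 0 := fun f hf => by
    by_contra! h
    exact hf (b.repr.map_eq_zero_iff.1 (by ext i; simpa [b.repr_apply_apply] using h i))
  refine ⟨Set.range f, fun n => l (e n), fun n => b (e n),
    b.orthonormal.comp _ (Subtype.val_injective.comp e.injective), fun n => hl0 _,
    fun n => hmod _, ?_, fun z hz => ?_, fun hsep => ?_, ?_⟩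
  · ext z
    simp only [Set.mem_range, Set.mem_ofPred_eq]
    constructor
    · rintro ⟨n, rfl⟩
      exact hasEigenvalue_of_hasEigenvector
        (hasEigenvector_iff.2 ⟨mem_eigenspace_iff.2 (hmod _), b.orthonormal.ne_zero _⟩)
    · intro h
      obtain ⟨x, hx⟩ := h.exists_hasEigenvector
      obtain ⟨i, hi⟩ := hne x hx.2
      have hz := hT.eq_of_operatorModulus_apply hl0 hl (mem_eigenspace_iff.1 hx.1) hi
      obtain ⟨j, hjS, hj⟩ : ∃ j ∈ S, l j = l i := by
        rcases (hl0 i).eq_or_lt with h0 | h0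
        · rw [← h0]; exact hSzero i h0.symm
        · exact ⟨i, hSpos i h0, rfl⟩
      exact ⟨e.symm ⟨j, hjS⟩, by simp [hj, hz]⟩
  · apply le_antisymm
    · rw [Submodule.span_le]
      rintro _ ⟨n, rfl, rfl⟩
      exact mem_eigenspace_iff.2 (hmod _)
    · intro x hx
      have hx' := fun i => hT.eq_of_operatorModulus_apply (i := i) hl0 hl (mem_eigenspace_iff.1 hx)
      have hmem : ∀ i, inner ℂ (b i) x • b i ∈
          Submodule.span ℂ ((fun n => b (e n)) '' {n | l (e n) = z}) := fun i => by
        by_cases hi : inner ℂ (b i) x = 0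
        · rw [hi, zero_smul]; exact Submodule.zero_mem _
        · have hiz : l i = z := by exact_mod_cast hx' i hi
          have hiS : i ∈ S := hSpos i ((hl0 i).lt_of_ne (hiz ▸ hz.symm))
          refine Submodule.smul_mem _ _ (Submodule.subset_span ⟨e.symm ⟨i, hiS⟩, ?_, ?_⟩) <;>
            simp [hiz]
      -- Only finitely many `l i` equal `z ≠ 0`, so the span needs no closure.
      have hsupp : {i | inner ℂ (b i) x ≠ 0}.Finite := by
        rcases lt_or_ge 0 z with h | h
        · refine (hT.finite_le_singularValue hcomp hl h).subset fun i hi => ?_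
          have hiz : l i = z := by exact_mod_cast hx' i hi
          exact hiz.ge
        · refine Set.finite_empty.subset fun i hi => ?_
          have hiz : l i = z := by exact_mod_cast hx' i hi
          exact hz (le_antisymm h (hiz ▸ hl0 i))
      have hsum := b.hasSum_repr x
      simp only [b.repr_apply_apply] at hsum
      rw [hsum.unique (hasSum_sum_of_ne_finset_zero (s := hsupp.toFinset) fun i hi => by
        have : inner ℂ (b i) x = 0 := by simpa using hi
        rw [this, zero_smul])]
      exact Submodule.sum_mem _ fun i _ => hmem i
  · have hr : Set.range (fun n => b (e n)) = Set.range b := by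
      ext x
      simp only [Set.mem_range]
      exact ⟨fun ⟨n, hn⟩ => ⟨_, hn⟩,
        fun ⟨i, hi⟩ => ⟨e.symm ⟨i, by simp [hSall hsep]⟩, by simpa using hi⟩⟩
    rw [hr]
    exact b.dense_span
  · have h := hT.hasSum_rankOne hcomp hl0 hl
    rw [← hasSum_subtype_iff_of_support_subset (s := S)] at h
    · exact (e.hasSum_iff (f := fun i : S => (l i : ℂ) •
        InnerProductSpace.rankOne ℂ (C (b i)) (b i))).2 h
    · intro i hi
      refine hSpos i ((hl0 i).lt_of_ne fun h0 => hi ?_)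
      simp [← h0]

end IsCSymmetric

end Expansion

/-! ### Compactness of Hilbert–Schmidt operators -/

section HilbertSchmidt

open Filter Topology

variable {H : Type*} [NormedAddCommGroup H] [InnerProductSpace ℂ H]

theorem InnerProductSpace.isCompactOperator_rankOne (x y : H) :
    IsCompactOperator (InnerProductSpace.rankOne ℂ x y) := by
  have h : IsCompactOperator (innerSL ℂ y) :=
    isCompactOperator_of_locallyCompactSpace_dom (innerSL ℂ y)
  rw [InnerProductSpace.rankOne_def']
  exact h.clm_comp (ContinuousLinearMap.toSpanSingleton ℂ x)

theorem IsCompactOperator.sum {ι : Type*} (F : Finset ι) (f : ι → H →L[ℂ] H)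
    (h : ∀ i ∈ F, IsCompactOperator (f i)) : IsCompactOperator (∑ i ∈ F, f i : H →L[ℂ] H) :=
  Submodule.sum_mem (compactOperator (RingHom.id ℂ) H H) h

/-- A Hilbert–Schmidt operator is compact. -/
theorem isCompactOperator_of_summable_norm_sq [CompleteSpace H] {ι : Type*}
    (b : HilbertBasis ι ℂ H) (T : H →L[ℂ] H) (h : Summable fun i => ‖T (b i)‖ ^ 2) :
    IsCompactOperator T := by
  classical
  refine isCompactOperator_of_tendsto (l := atTop)
    (F := fun F : Finset ι => ∑ i ∈ F, InnerProductSpace.rankOne ℂ (T (b i)) (b i)) ?_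
    (Eventually.of_forall fun F => IsCompactOperator.sum F _
      fun i _ => InnerProductSpace.isCompactOperator_rankOne _ _)
  rw [Metric.tendsto_atTop]
  intro ε hε
  obtain ⟨F₀, hF₀⟩ := summable_iff_vanishing_norm.1 h ((ε / 2) ^ 2) (by positivity)
  refine ⟨F₀, fun F hF => ?_⟩
  rw [dist_comm, dist_eq_norm]
  refine lt_of_le_of_lt ?_ (half_lt_self hε)
  refine ContinuousLinearMap.opNorm_le_bound _ (half_pos hε).le fun x => ?_
  -- The finite sum is treated as a series over `ι`, so termwise subtraction leaves partial sums
  -- over `G \ F`, which Cauchy–Schwarz and Bessel control.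
  have hsum := ((b.hasSum_repr x).mapL T).sub
    (hasSum_sum_of_ne_finset_zero (s := F)
      (f := fun i => if i ∈ F then inner ℂ (b i) x • T (b i) else 0) (by simp +contextual))
  have hval : (T - ∑ i ∈ F, InnerProductSpace.rankOne ℂ (T (b i)) (b i)) x =
      T x - ∑ i ∈ F, if i ∈ F then inner ℂ (b i) x • T (b i) else 0 := by
    rw [_root_.sub_apply, _root_.sum_apply]
    congr 1
    exact Finset.sum_congr rfl fun i hi => by simp [hi]
  rw [hval]
  refine le_of_tendsto hsum.norm (Eventually.of_forall fun G => ?_)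
  have hG : ∑ i ∈ G, (T (b.repr x i • b i) - if i ∈ F then inner ℂ (b i) x • T (b i) else 0) =
      ∑ i ∈ G \ F, inner ℂ (b i) x • T (b i) := by
    rw [Finset.sdiff_eq_filter, Finset.sum_filter]
    refine Finset.sum_congr rfl fun i _ => ?_
    by_cases hi : i ∈ F <;> simp [hi, b.repr_apply_apply]
  rw [hG]
  have h1 : ∑ i ∈ G \ F, ‖inner ℂ (b i) x‖ ^ 2 ≤ ‖x‖ ^ 2 := b.orthonormal.sum_inner_products_le x
  have h2 : ∑ i ∈ G \ F, ‖T (b i)‖ ^ 2 ≤ (ε / 2) ^ 2 :=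
    (le_abs_self _).trans (hF₀ (G \ F) (Finset.disjoint_of_subset_right hF
      Finset.sdiff_disjoint)).le
  calc ‖∑ i ∈ G \ F, inner ℂ (b i) x • T (b i)‖
      ≤ ∑ i ∈ G \ F, ‖inner ℂ (b i) x‖ * ‖T (b i)‖ :=
        (norm_sum_le _ _).trans_eq (Finset.sum_congr rfl fun i _ => norm_smul _ _)
    _ ≤ ε / 2 * ‖x‖ := by
      refine abs_le_of_sq_le_sq' ?_ (by positivity) |>.2
      calc (∑ i ∈ G \ F, ‖inner ℂ (b i) x‖ * ‖T (b i)‖) ^ 2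
          ≤ (∑ i ∈ G \ F, ‖inner ℂ (b i) x‖ ^ 2) * ∑ i ∈ G \ F, ‖T (b i)‖ ^ 2 :=
            Finset.sum_mul_sq_le_sq_mul_sq _ _ _
        _ ≤ ‖x‖ ^ 2 * (ε / 2) ^ 2 := by gcongr
        _ = (ε / 2 * ‖x‖) ^ 2 := by ring

end HilbertSchmidt

/-! ### Integral operators with square-integrable kernel -/

section IntegralOperator

variable {Γ : Type*} [MeasurableSpace Γ] {μ : Measure Γ}

theorem norm_sq_eq_integral_norm_sq (f : Lp ℂ 2 μ) : ‖f‖ ^ 2 = ∫ x, ‖f x‖ ^ 2 ∂μ := by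
  have h : ((‖f‖ ^ 2 : ℝ) : ℂ) = ((∫ x, ‖f x‖ ^ 2 ∂μ : ℝ) : ℂ) := by
    have h1 := inner_self_eq_norm_sq_to_K (𝕜 := ℂ) f
    rw [L2.inner_def] at h1
    simp only [inner_self_eq_norm_sq_to_K] at h1
    rw [← integral_complex_ofReal]
    push_cast
    exact h1.symm
  exact_mod_cast h

theorem isConjugationOperator_conjLp : IsConjugationOperator (conjLp μ) where
  antilinear a b f g := by
    refine Lp.ext ?_
    filter_upwards [conjLp_coe μ (a • f + b • g), Lp.coeFn_add (a • f) (b • g),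
      Lp.coeFn_smul a f, Lp.coeFn_smul b g,
      Lp.coeFn_add ((starRingEnd ℂ) a • conjLp μ f) ((starRingEnd ℂ) b • conjLp μ g),
      Lp.coeFn_smul ((starRingEnd ℂ) a) (conjLp μ f),
      Lp.coeFn_smul ((starRingEnd ℂ) b) (conjLp μ g), conjLp_coe μ f, conjLp_coe μ g]
      with x h1 h2 h3 h4 h5 h6 h7 h8 h9
    rw [h1, h2, h5, Pi.add_apply, Pi.add_apply, h3, h4, h6, h7, Pi.smul_apply, Pi.smul_apply,
      Pi.smul_apply, Pi.smul_apply, h8, h9]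
    simp
  involutive f := star_star f
  isometric f g := by
    rw [L2.inner_def, L2.inner_def]
    refine integral_congr_ae ?_
    filter_upwards [conjLp_coe μ f, conjLp_coe μ g] with x hf hg
    simp [hf, hg, RCLike.inner_apply, mul_comm]

/-- Integration against a square-integrable function is represented by its conjugate. -/
theorem MeasureTheory.MemLp.exists_inner_eq_integral_mul {k : Γ → ℂ} (hk : MemLp k 2 μ) :
    ∃ κ : Lp ℂ 2 μ, (∀ f : Lp ℂ 2 μ, inner ℂ κ f = ∫ y, k y * f y ∂μ) ∧
      ‖κ‖ ^ 2 = ∫ y, ‖k y‖ ^ 2 ∂μ := by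
  refine ⟨hk.star.toLp _, fun f => ?_, ?_⟩
  · rw [L2.inner_def]
    refine integral_congr_ae ?_
    filter_upwards [hk.star.coeFn_toLp] with y hy
    rw [RCLike.inner_apply', hy]
    simp
  · rw [norm_sq_eq_integral_norm_sq]
    refine integral_congr_ae ?_
    filter_upwards [hk.star.coeFn_toLp] with y hy
    rw [hy]
    simp

theorem memLp_two_mul_prod [SFinite μ] {f g : Γ → ℂ} (hf : MemLp f 2 μ) (hg : MemLp g 2 μ) :
    MemLp (fun p : Γ × Γ => f p.1 * g p.2) 2 (μ.prod μ) := by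
  refine (memLp_two_iff_integrable_sq_norm (hf.1.comp_fst.mul hg.1.comp_snd)).2 ?_
  simp only [Pi.mul_apply, norm_mul, mul_pow]
  exact ((memLp_two_iff_integrable_sq_norm hf.1).1 hf).mul_prod
    ((memLp_two_iff_integrable_sq_norm hg.1).1 hg)

variable [SigmaFinite μ] {K : Γ → Γ → ℂ}

theorem ae_memLp_section (hK : MemLp (fun p : Γ × Γ => K p.1 p.2) 2 (μ.prod μ)) :
    ∀ᵐ x ∂μ, MemLp (K x) 2 μ := by
  filter_upwards [hK.1.prodMk_left, ((memLp_two_iff_integrable_sq_norm hK.1).1 hK).prod_right_ae]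
    with x h1 h2
  exact (memLp_two_iff_integrable_sq_norm h1).2 h2

theorem memLp_integral_mul (hK : MemLp (fun p : Γ × Γ => K p.1 p.2) 2 (μ.prod μ))
    (f : Lp ℂ 2 μ) : MemLp (fun x => ∫ y, K x y * f y ∂μ) 2 μ := by
  have hm : AEStronglyMeasurable (fun x => ∫ y, K x y * f y ∂μ) μ :=
    (hK.1.mul (Lp.aestronglyMeasurable f).comp_snd).integral_prod_right'
  rw [memLp_two_iff_integrable_sq_norm hm]
  have hint := ((memLp_two_iff_integrable_sq_norm hK.1).1 hK).integral_prod_left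
  refine (hint.mul_const (‖f‖ ^ 2)).mono' (hm.norm.pow 2) ?_
  filter_upwards [ae_memLp_section hK] with x hx
  obtain ⟨κ, hκ, hκ'⟩ := hx.exists_inner_eq_integral_mul
  rw [← hκ, ← hκ', Real.norm_eq_abs, abs_of_nonneg (by positivity), ← mul_pow]
  gcongr
  exact norm_inner_le_norm κ f

theorem ae_integrable_mul (hK : MemLp (fun p : Γ × Γ => K p.1 p.2) 2 (μ.prod μ))
    (f : Lp ℂ 2 μ) : ∀ᵐ x ∂μ, Integrable (fun y => K x y * f y) μ := by
  filter_upwards [ae_memLp_section hK] with x hx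
  exact hx.integrable_mul (Lp.memLp f)

/-- Apply `hv` to the vector representing `K x` and integrate over `x`. One vector with
Cauchy–Schwarz gives boundedness; an orthonormal family with Bessel gives the Hilbert–Schmidt bound.
-/
theorem norm_toLp_integral_mul_sq_le (hK : MemLp (fun p : Γ × Γ => K p.1 p.2) 2 (μ.prod μ))
    {ι : Type*} (s : Finset ι) (v : ι → Lp ℂ 2 μ) (c : ℝ)
    (hv : ∀ κ : Lp ℂ 2 μ, ∑ i ∈ s, ‖inner ℂ κ (v i)‖ ^ 2 ≤ ‖κ‖ ^ 2 * c) :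
    ∑ i ∈ s, ‖(memLp_integral_mul hK (v i)).toLp‖ ^ 2 ≤
      (∫ x, ∫ y, ‖K x y‖ ^ 2 ∂μ ∂μ) * c := by
  have h1 : ∀ i, ‖(memLp_integral_mul hK (v i)).toLp‖ ^ 2 =
      ∫ x, ‖∫ y, K x y * v i y ∂μ‖ ^ 2 ∂μ := fun i => by
    rw [norm_sq_eq_integral_norm_sq]
    refine integral_congr_ae ?_
    filter_upwards [(memLp_integral_mul hK (v i)).coeFn_toLp] with x hx
    rw [hx]
  have hi : ∀ i, Integrable (fun x => ‖∫ y, K x y * v i y ∂μ‖ ^ 2) μ := fun i =>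
    (memLp_two_iff_integrable_sq_norm (memLp_integral_mul hK (v i)).1).1
      (memLp_integral_mul hK (v i))
  simp only [h1]
  rw [← integral_finsetSum _ fun i _ => hi i, ← integral_mul_const]
  have hint := ((memLp_two_iff_integrable_sq_norm hK.1).1 hK).integral_prod_left
  refine integral_mono_ae (integrable_finsetSum _ fun i _ => hi i) (hint.mul_const c) ?_
  filter_upwards [ae_memLp_section hK] with x hx
  obtain ⟨κ, hκ, hκ'⟩ := hx.exists_inner_eq_integral_mul
  simp only [← hκ, ← hκ']
  exact hv κ

/-- A square-integrable kernel defines a bounded integral operator on `L²`. -/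
theorem exists_isIntegralOperator (hK : MemLp (fun p : Γ × Γ => K p.1 p.2) 2 (μ.prod μ)) :
    ∃ T : Lp ℂ 2 μ →L[ℂ] Lp ℂ 2 μ, IsIntegralOperator μ K T := by
  set M := ∫ x, ∫ y, ‖K x y‖ ^ 2 ∂μ ∂μ with hM
  have hM0 : 0 ≤ M := integral_nonneg fun x => integral_nonneg fun y => by positivity
  let T₀ : Lp ℂ 2 μ →ₗ[ℂ] Lp ℂ 2 μ :=
    { toFun := fun f => (memLp_integral_mul hK f).toLp
      map_add' := fun f g => by
        refine Lp.ext ?_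
        filter_upwards [(memLp_integral_mul hK (f + g)).coeFn_toLp,
          (memLp_integral_mul hK f).coeFn_toLp, (memLp_integral_mul hK g).coeFn_toLp,
          Lp.coeFn_add (memLp_integral_mul hK f).toLp (memLp_integral_mul hK g).toLp,
          ae_integrable_mul hK f, ae_integrable_mul hK g] with x h1 h2 h3 h4 h5 h6
        rw [h1, h4, Pi.add_apply, h2, h3, ← integral_add h5 h6]
        refine integral_congr_ae ?_
        filter_upwards [Lp.coeFn_add f g] with y hy
        rw [hy, Pi.add_apply, mul_add]
      map_smul' := fun a f => by
        refine Lp.ext ?_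
        filter_upwards [(memLp_integral_mul hK (a • f)).coeFn_toLp,
          (memLp_integral_mul hK f).coeFn_toLp,
          Lp.coeFn_smul a (memLp_integral_mul hK f).toLp] with x h1 h2 h3
        rw [h1, RingHom.id_apply, h3, Pi.smul_apply, h2, smul_eq_mul, ← integral_const_mul]
        refine integral_congr_ae ?_
        filter_upwards [Lp.coeFn_smul a f] with y hy
        rw [hy, Pi.smul_apply, smul_eq_mul, mul_left_comm] }
  refine ⟨T₀.mkContinuous (√M) fun f => ?_, fun f =>
    ⟨ae_integrable_mul hK f, (memLp_integral_mul hK f).coeFn_toLp⟩⟩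
  have h := norm_toLp_integral_mul_sq_le hK {()} (fun _ => f) (‖f‖ ^ 2) fun κ => by
    rw [Finset.sum_singleton, ← mul_pow]
    gcongr
    exact norm_inner_le_norm κ f
  rw [Finset.sum_singleton, ← hM] at h
  refine abs_le_of_sq_le_sq' ?_ (by positivity) |>.2
  rwa [mul_pow, Real.sq_sqrt hM0]

theorem IsIntegralOperator.isCompactOperator
    (hK : MemLp (fun p : Γ × Γ => K p.1 p.2) 2 (μ.prod μ)) {T : Lp ℂ 2 μ →L[ℂ] Lp ℂ 2 μ}
    (hT : IsIntegralOperator μ K T) : IsCompactOperator T := by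
  obtain ⟨w, b, -⟩ := exists_hilbertBasis ℂ (Lp ℂ 2 μ)
  refine isCompactOperator_of_summable_norm_sq b T ?_
  refine summable_of_sum_le (c := (∫ x, ∫ y, ‖K x y‖ ^ 2 ∂μ ∂μ) * 1) (fun i => by positivity)
    fun s => ?_
  have hTf : ∀ f, T f = (memLp_integral_mul hK f).toLp := fun f =>
    Lp.ext ((hT f).2.trans (memLp_integral_mul hK f).coeFn_toLp.symm)
  simp only [hTf]
  refine norm_toLp_integral_mul_sq_le hK s b 1 fun κ => ?_
  rw [mul_one]
  simpa only [norm_inner_symm] using b.orthonormal.sum_inner_products_le κ (s := s)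

/-- Tested against `g`, both sides become the double integral of `K x y * g x * f y`, after using
the symmetry of `K` and swapping the variables. -/
theorem IsIntegralOperator.isCSymmetric
    (hK : MemLp (fun p : Γ × Γ => K p.1 p.2) 2 (μ.prod μ))
    (hsymm : ∀ᵐ p : Γ × Γ ∂(μ.prod μ), K p.1 p.2 = K p.2 p.1) {T : Lp ℂ 2 μ →L[ℂ] Lp ℂ 2 μ}
    (hT : IsIntegralOperator μ K T) : IsCSymmetric (conjLp μ) T where
  conjugation := isConjugationOperator_conjLp
  comm f := by
    refine ext_inner_right ℂ fun g => ?_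
    rw [ContinuousLinearMap.adjoint_inner_left, L2.inner_def, L2.inner_def]
    have hint : Integrable (fun p : Γ × Γ => K p.1 p.2 * (g p.1 * f p.2)) (μ.prod μ) :=
      hK.integrable_mul (memLp_two_mul_prod (Lp.memLp g) (Lp.memLp f))
    calc ∫ x, inner ℂ (conjLp μ (T f) x) (g x) ∂μ
        = ∫ x, ∫ y, K x y * (g x * f y) ∂μ ∂μ := by
          refine integral_congr_ae ?_
          filter_upwards [conjLp_coe μ (T f), (hT f).2] with x h1 h2
          rw [RCLike.inner_apply', h1, h2, Complex.conj_conj, ← integral_mul_const]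
          exact integral_congr_ae (Filter.Eventually.of_forall fun y => by ring)
      _ = ∫ p, K p.1 p.2 * (g p.1 * f p.2) ∂(μ.prod μ) := (integral_prod _ hint).symm
      _ = ∫ p, K p.2 p.1 * (g p.1 * f p.2) ∂(μ.prod μ) := by
          refine integral_congr_ae ?_
          filter_upwards [hsymm] with p hp
          rw [hp]
      _ = ∫ p, K p.1 p.2 * (g p.2 * f p.1) ∂(μ.prod μ) :=
          integral_prod_swap (fun p : Γ × Γ => K p.1 p.2 * (g p.2 * f p.1))
      _ = ∫ x, ∫ y, K x y * (g y * f x) ∂μ ∂μ := by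
          refine integral_prod _ ?_
          have := hK.integrable_mul (memLp_two_mul_prod (Lp.memLp f) (Lp.memLp g))
          refine this.congr (Filter.Eventually.of_forall fun p => ?_)
          simp [mul_comm]
      _ = ∫ x, inner ℂ (conjLp μ f x) (T g x) ∂μ := by
          refine integral_congr_ae ?_
          filter_upwards [conjLp_coe μ f, (hT g).2] with x h1 h2
          rw [RCLike.inner_apply', h1, h2, Complex.conj_conj, ← integral_const_mul]
          exact integral_congr_ae (Filter.Eventually.of_forall fun y => by ring)

end IntegralOperator

theorem mainTheorem1 {Γ : Type*} [MeasurableSpace Γ] (μ : Measure Γ) [SigmaFinite μ]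
    (K : Γ → Γ → ℂ) (hK : MemLp (fun p : Γ × Γ => K p.1 p.2) 2 (μ.prod μ))
    (hsymm : ∀ᵐ p : Γ × Γ ∂(μ.prod μ), K p.1 p.2 = K p.2 p.1) :
    ∃ T : Lp ℂ 2 μ →L[ℂ] Lp ℂ 2 μ,
      IsIntegralOperator μ K T ∧
      IsCompactOperator T ∧
      IsCSymmetric (conjLp μ) T ∧
      ∃ (N : Set ℕ) (l : N → ℝ) (φ : N → Lp ℂ 2 μ),
        Orthonormal ℂ φ ∧
        (∀ n, 0 ≤ l n) ∧
        (∀ n, operatorModulus T (φ n) = (l n : ℂ) • φ n) ∧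
        -- the `l n` are exactly the eigenvalues of `|T|`
        Set.range (fun n => (l n : ℂ)) =
          {z : ℂ | Module.End.HasEigenvalue (operatorModulus T : Lp ℂ 2 μ →ₗ[ℂ] Lp ℂ 2 μ) z} ∧
        -- nonzero eigenvalues are listed with their full multiplicity
        (∀ z : ℝ, z ≠ 0 →
          Submodule.span ℂ (φ '' {n | l n = z}) =
            Module.End.eigenspace (operatorModulus T : Lp ℂ 2 μ →ₗ[ℂ] Lp ℂ 2 μ) (z : ℂ)) ∧
        -- the eigenfunctions are complete when the space is separable
        (TopologicalSpace.SeparableSpace (Lp ℂ 2 μ) →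
          (Submodule.span ℂ (Set.range φ)).topologicalClosure = ⊤) ∧
        -- `T = ∑ l n ⟨·, φ n⟩ conj (φ n)`, converging in operator norm
        HasSum (fun n => (l n : ℂ) • InnerProductSpace.rankOne ℂ (conjLp μ (φ n)) (φ n)) T := by
  obtain ⟨T, hT⟩ := exists_isIntegralOperator hK
  have hcomp := hT.isCompactOperator hK
  have hC := hT.isCSymmetric hK hsymm
  exact ⟨T, hT, hcomp, hC, hC.exists_expansion hcomp⟩
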